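/- **Theorem 1.** Let $v_1,\dots,v_n\in\mathbb{R}^d$ be the embeddings of the $n$ entities of a knowledge graph, with $\|v_i\|_2\le\kappa\sqrt d$ for all $i$, and let a relation $R$ be represented by two orthogonal matrices $R_1,R_2\in\mathbb{R}^{d\times d}$, $d\ge 1$. For a knowledge vector $c$ put $$Z^{(j)}_c=\sum_{i=1}^n\exp(v_i^\top R_j c)\quad(j=1,2),\qquad p(h\mid R,c)=\frac{\exp(h^\top R_1c)}{Z^{(1)}_c},\qquad p(t\mid R,c')=\frac{\exp(t^\top R_2c')}{Z^{(2)}_{c'}},$$ where an entity is identified with its embedding. Let $(c_k)_{k\ge0}$ be a slow random walk of knowledge vectors: every $c_k$ is uniformly distributed on the unit sphere of $\mathbb{R}^d$, and $\|c_k-c_{k+1}\|_2\le\epsilon_2$ almost surely. Let $$p(h,t\mid R)=\mathbb{E}_{c,c'}\bigl[p(h\mid R,c)\,p(t\mid R,c')\bigr],\qquad c=c_k,\ c'=c_{k+1}.$$ Assume the concentration condition: for some $Z>0$, with $c$ uniform on the unit sphere, $$\Pr_c\bigl[(1-\epsilon_z)Z\le Z^{(1)}_c\le(1+\epsilon_z)Z\bigr]\ge1-\delta,\qquad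 0\le\epsilon_z\le K/\sqrt n,\quad \delta\le\exp(-a\log^2 n),$$ with constants $K,a>0$. Then $Z^{(2)}_{c'}$ satisfies the same concentration inequality with the same $Z,\epsilon_z,\delta$, so that $Z$ is the common concentrated value of both partition functions, and for all $n\ge N$, all $k$ and all entities $h,t$ $$\log p(h,t\mid R)=\frac{\|R_1^\top h+R_2^\top t\|_2^2}{2d}-2\log Z\pm\epsilon,\qquad \epsilon\le C\Bigl(\frac1{\sqrt n}+\frac{(1+\log d)^q}{d}+\sqrt d\,\epsilon_2\Bigr).$$ Here $q$ is an absolute constant, and $C$ and $N$ depend only on $\kappa,K,a$. In particular, if the walk is so slow that $\sqrt d\,\epsilon_2=O(1/\sqrt n)+\widetilde O(1/d)$, then $\epsilon=O(1/\sqrt n)+\widetilde O(1/d)$. -/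

import Mathlib

open MeasureTheory ProbabilityTheory

noncomputable section

namespace RelWalk

/-- `ℝ^d` with its Euclidean norm. -/
abbrev E (d : ℕ) : Type := EuclideanSpace ℝ (Fin d)

/-- The uniform probability distribution on the unit sphere of `ℝ^d` (for `d ≥ 1`), as a measure on
`ℝ^d`: the surface measure of the sphere divided by its total mass. -/
def uniformSphere (d : ℕ) : Measure (E d) :=
  (((volume : Measure (E d)).toSphere Set.univ)⁻¹ • (volume : Measure (E d)).toSphere).map
    (Subtype.val : Metric.sphere (0 : E d) 1 → E d)

/-- The score `vᵀ R c` of an entity vector `v` for an argument matrix `R` and a knowledge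
vector `c`. -/
def score {d : ℕ} (R : Matrix (Fin d) (Fin d) ℝ) (v c : E d) : ℝ :=
  inner ℝ v (Matrix.toEuclideanLin R c)

/-- The partition function `∑ v, exp (vᵀ R c)` over the vocabulary of `n` entities with
embeddings `v`. -/
def partitionFn {n d : ℕ} (v : Fin n → E d) (R : Matrix (Fin d) (Fin d) ℝ) (c : E d) : ℝ :=
  ∑ i, Real.exp (score R (v i) c)

/-- The loglinear entity production model `exp (vᵀ R c) / ∑ v, exp (vᵀ R c)`. -/
def entityProb {n d : ℕ} (v : Fin n → E d) (R : Matrix (Fin d) (Fin d) ℝ) (c : E d)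
    (i : Fin n) : ℝ :=
  Real.exp (score R (v i) c) / partitionFn v R c

/-- For `c` uniform on the unit sphere, the partition function lies in
`[(1 - εz) Z, (1 + εz) Z]` with probability at least `1 - δ`. -/
def Concentrated {n d : ℕ} (v : Fin n → E d) (R : Matrix (Fin d) (Fin d) ℝ)
    (Z εz δ : ℝ) : Prop :=
  1 - δ ≤ (uniformSphere d).real
    {c | (1 - εz) * Z ≤ partitionFn v R c ∧ partitionFn v R c ≤ (1 + εz) * Z}

/-- A slow random walk of knowledge vectors: every `c k` is uniform on the unit sphere, and
consecutive vectors are almost surely at distance at most `ε₂`. -/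
structure IsSlowWalk {Ω : Type*} [MeasurableSpace Ω] (P : Measure Ω) {d : ℕ}
    (c : ℕ → Ω → E d) (ε₂ : ℝ) : Prop where
  measurable : ∀ k, Measurable (c k)
  uniform : ∀ k, P.map (c k) = uniformSphere d
  slow : ∀ k, ∀ᵐ ω ∂P, ‖c k ω - c (k + 1) ω‖ ≤ ε₂

/-- `p(h, t | R)`: the expectation of `p(h | R, c) p(t | R, c')` over the knowledge vectors
`c`, `c'` of the two generation steps. -/
def jointProb {Ω : Type*} [MeasurableSpace Ω] (P : Measure Ω) {n d : ℕ} (v : Fin n → E d)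
    (R₁ R₂ : Matrix (Fin d) (Fin d) ℝ) (c c' : Ω → E d) (h t : Fin n) : ℝ :=
  ∫ ω, entityProb v R₁ (c ω) h * entityProb v R₂ (c' ω) t ∂P

end RelWalk

end

/-! Write `w = R₁ᵀh + R₂ᵀt`. When both partition functions lie in their windows, the integrand is
`exp ⟨w, c⟩ / Z²` up to factors `(1 ± εz)⁻²` and `exp (± κ √d ε₂)`; the latter is the cost of
replacing `c'` by `c`. Two points remain.

The mean `𝔼 exp ⟨w, c⟩` on the sphere: a Gaussian integral in polar coordinates gives a recursion
for the even moments of a coordinate. They are at most the moments of `N(0, 1/d)`, with relative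
deficit at most `k(k-1)/d`, so the logarithm of the mean is `‖w‖²/(2d) + O(1/d)`
(`abs_log_integral_exp_inner_sub_le`).

The exceptional event, of probability at most `2ρ²` with `ρ = O(1/√n)`: `n p(h | R, c)` has a
bounded fourth moment with no lower bound on the partition function, by Jensen
(`integral_card_mul_entityProb_pow_four_le`). This event therefore contributes `O(ρ/n²)`, and `Z =
O(n)` makes that `O(ρ/Z²)`. Independence of `c` and `c'` plays no role. -/

noncomputable section

namespace RelWalk

open Set Metric
open scoped Pointwise

/-! ### The uniform measure on the sphere and its rotation invariance -/

instance nontrivial_E {d : ℕ} [NeZero d] : Nontrivial (E d) := by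
  have : Nonempty (Fin d) := ⟨0⟩
  infer_instance

lemma toSphere_univ_ne_zero {d : ℕ} [NeZero d] :
    (volume : Measure (E d)).toSphere.real univ ≠ 0 := by
  rw [Measure.real, ENNReal.toReal_ne_zero]
  refine ⟨?_, measure_ne_top _ _⟩
  rw [Ne, Measure.measure_univ_eq_zero]
  exact Measure.toSphere_ne_zero _

lemma integral_uniformSphere {d : ℕ} (f : E d → ℝ) :
    ∫ c, f c ∂(uniformSphere d) =
      ((volume : Measure (E d)).toSphere.real univ)⁻¹ *
        ∫ x, f x ∂(volume : Measure (E d)).toSphere := by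
  have hemb : MeasurableEmbedding (Subtype.val : sphere (0 : E d) 1 → E d) :=
    MeasurableEmbedding.subtype_coe isClosed_sphere.measurableSet
  rw [uniformSphere, hemb.integral_map, integral_smul_measure]
  simp [measureReal_def]

instance isProbabilityMeasure_uniformSphere {d : ℕ} [NeZero d] :
    IsProbabilityMeasure (uniformSphere d) := by
  constructor
  rw [uniformSphere, Measure.map_apply measurable_subtype_coe MeasurableSet.univ]
  rw [preimage_univ, Measure.smul_apply, smul_eq_mul]
  exact ENNReal.inv_mul_cancel (ENNReal.toReal_ne_zero.1 toSphere_univ_ne_zero).1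
    (measure_ne_top _ _)

lemma ae_norm_eq_one_uniformSphere (d : ℕ) : ∀ᵐ c ∂(uniformSphere d), ‖c‖ = 1 := by
  rw [uniformSphere, ae_map_iff measurable_subtype_coe.aemeasurable
    (measurableSet_eq_fun measurable_norm measurable_const)]
  exact Filter.Eventually.of_forall fun x => by simp

/-- Surface measure is a constant times the volume of the cone over a set; a linear isometry
preserves volume and commutes with forming cones. -/
lemma map_uniformSphere {d : ℕ} (f : E d ≃ₗᵢ[ℝ] E d) :
    (uniformSphere d).map f = uniformSphere d := by
  ext s hs
  have hf : Measurable f := f.continuous.measurable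
  rw [Measure.map_apply hf hs]
  rw [uniformSphere, Measure.map_apply measurable_subtype_coe hs,
    Measure.map_apply measurable_subtype_coe (hf hs), Measure.smul_apply, Measure.smul_apply,
    Measure.toSphere_apply' _ (measurable_subtype_coe hs),
    Measure.toSphere_apply' _ (measurable_subtype_coe (hf hs))]
  congr 2
  symm
  rw [← (LinearIsometryEquiv.measurePreserving f).measure_preimage_equiv (f := f.toMeasurableEquiv)]
  congr 1
  ext x
  simp only [mem_smul, mem_image, mem_preimage, Subtype.exists]
  constructor
  · rintro ⟨r, hr, y, ⟨z, hz, hzs, rfl⟩, h⟩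
    refine ⟨r, hr, f.symm z, ⟨f.symm z, by simpa using hz, by simpa using hzs, rfl⟩, ?_⟩
    apply f.injective
    simpa using h
  · rintro ⟨r, hr, y, ⟨z, hz, hzs, rfl⟩, rfl⟩
    exact ⟨r, hr, f z, ⟨f z, by simpa using hz, hzs, rfl⟩, by simp⟩

lemma integral_uniformSphere_comp {d : ℕ} (f : E d ≃ₗᵢ[ℝ] E d) (g : E d → ℝ) :
    ∫ c, g (f c) ∂(uniformSphere d) = ∫ c, g c ∂(uniformSphere d) := by
  conv_rhs => rw [← map_uniformSphere f]
  exact (f.toHomeomorph.measurableEmbedding.integral_map g).symm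

/-- The distribution of an inner product with a uniform point depends only on the norm of the
fixed vector. -/
lemma integral_uniformSphere_inner_congr {d : ℕ} {u w : E d} (h : ‖u‖ = ‖w‖) (g : ℝ → ℝ) :
    ∫ c, g (inner ℝ u c) ∂(uniformSphere d) = ∫ c, g (inner ℝ w c) ∂(uniformSphere d) := by
  set f := (ℝ ∙ (u - w))ᗮ.reflection with hf
  have hfu : f u = w := Submodule.reflection_sub h
  rw [← integral_uniformSphere_comp f (fun c => g (inner ℝ w c))]
  simp only [← hfu, LinearIsometryEquiv.inner_map_map]

/-! ### Gaussian integrals and the moments of a coordinate -/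

/-- Integration in polar coordinates of a product of a radial and an angular function. -/
lemma integral_mul_radial {d : ℕ} [NeZero d] (F : E d → ℝ) (φ : ℝ → ℝ) :
    ∫ x : E d, F (‖x‖⁻¹ • x) * φ ‖x‖ =
      (∫ x, F x ∂(volume : Measure (E d)).toSphere) *
        ∫ r in Ioi (0 : ℝ), r ^ (d - 1) * φ r := by
  let μ : Measure (E d) := volume
  calc
    ∫ x : E d, F (‖x‖⁻¹ • x) * φ ‖x‖ =
        ∫ x : ({(0)}ᶜ : Set (E d)), F (‖x.1‖⁻¹ • x.1) * φ ‖x.1‖ ∂(μ.comap (↑)) := by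
      rw [integral_subtype_comap (measurableSet_singleton _).compl
        fun x : E d ↦ F (‖x‖⁻¹ • x) * φ ‖x‖, restrict_compl_singleton]
    _ = ∫ x, F x.1 * φ x.2 ∂μ.toSphere.prod (.volumeIoiPow (Module.finrank ℝ (E d) - 1)) := by
      have := μ.measurePreserving_homeomorphUnitSphereProd.integral_comp
        (Homeomorph.measurableEmbedding _) (fun x => F x.1 * φ x.2)
      simpa using this
    _ = (∫ x, F x ∂μ.toSphere) *
          ∫ x : Ioi (0 : ℝ), φ x ∂.volumeIoiPow (Module.finrank ℝ (E d) - 1) :=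
      integral_prod_mul (fun x : sphere (0 : E d) 1 => F x) (fun r : Ioi (0 : ℝ) => φ r)
    _ = _ := by
      congr 1
      simp only [Measure.volumeIoiPow, ENNReal.ofReal, finrank_euclideanSpace, Fintype.card_fin]
      rw [integral_withDensity_eq_integral_smul,
        integral_subtype_comap measurableSet_Ioi fun a ↦ Real.toNNReal (a ^ (d - 1)) • φ a,
        setIntegral_congr_fun measurableSet_Ioi fun x hx ↦ ?_]
      · simp only [NNReal.smul_def, smul_eq_mul]
        rw [Real.coe_toNNReal _ (pow_nonneg hx.out.le _)]
      · exact (measurable_subtype_coe.pow_const _).real_toNNReal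

/-- The half-line Gaussian moment `∫₀^∞ r ^ s exp (-r² / 2)`. -/
def gaussMoment (s : ℕ) : ℝ := ∫ r in Ioi (0 : ℝ), r ^ s * Real.exp (-(r ^ 2) / 2)

lemma gaussMoment_eq (s : ℕ) :
    gaussMoment s = (1 / 2 : ℝ) ^ (-((s : ℝ) + 1) / 2) * (1 / 2) * Real.Gamma (((s : ℝ) + 1) / 2) := by
  have h := integral_rpow_mul_exp_neg_mul_rpow (p := 2) (q := s) (b := 1 / 2) two_pos
    (by linarith [Nat.cast_nonneg (α := ℝ) s]) (by norm_num)
  rw [← h, gaussMoment]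
  refine setIntegral_congr_fun measurableSet_Ioi fun r _ => ?_
  simp only [Real.rpow_natCast, Real.rpow_two]
  congr 2
  ring

lemma gaussMoment_pos (s : ℕ) : 0 < gaussMoment s := by
  rw [gaussMoment_eq]
  have : 0 < Real.Gamma (((s : ℝ) + 1) / 2) := Real.Gamma_pos_of_pos (by positivity)
  positivity

lemma gaussMoment_add_two (s : ℕ) : gaussMoment (s + 2) = (s + 1) * gaussMoment s := by
  rw [gaussMoment_eq, gaussMoment_eq]
  have h1 : (((s + 2 : ℕ) : ℝ) + 1) / 2 = ((s : ℝ) + 1) / 2 + 1 := by push_cast; ring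
  have h2 : -(((s + 2 : ℕ) : ℝ) + 1) / 2 = -((s : ℝ) + 1) / 2 - 1 := by push_cast; ring
  rw [h1, h2, Real.Gamma_add_one (by positivity), Real.rpow_sub_one (by norm_num)]
  ring

lemma integral_even_pow_mul_gauss (k : ℕ) :
    ∫ x : ℝ, x ^ (2 * k) * Real.exp (-(x ^ 2) / 2) = 2 * gaussMoment (2 * k) := by
  have h := integral_comp_abs (f := fun x => x ^ (2 * k) * Real.exp (-(x ^ 2) / 2))
  rw [gaussMoment, ← h]
  congr 1
  ext x
  simp [pow_mul]

/-- The Gaussian weight factors over coordinates, and each full-line factor is twice a half-line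
moment. -/
lemma integral_coord_pow_mul_gauss {d : ℕ} [NeZero d] (k : ℕ) :
    ∫ x : E d, x 0 ^ (2 * k) * Real.exp (-(‖x‖ ^ 2) / 2) =
      2 ^ d * gaussMoment 0 ^ (d - 1) * gaussMoment (2 * k) := by
  rw [← (PiLp.volume_preserving_toLp (Fin d)).integral_comp
    (MeasurableEquiv.toLp 2 (Fin d → ℝ)).measurableEmbedding]
  have h := integral_fintype_prod_volume_eq_prod (ι := Fin d) (𝕜 := ℝ)
    (fun (i : Fin d) (x : ℝ) => x ^ (if i = 0 then 2 * k else 0) * Real.exp (-(x ^ 2) / 2))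
  have hl : ∀ x : Fin d → ℝ,
      ∏ i, (x i ^ (if i = 0 then 2 * k else 0) * Real.exp (-(x i ^ 2) / 2)) =
      (WithLp.toLp 2 x : E d) 0 ^ (2 * k) * Real.exp (-(‖(WithLp.toLp 2 x : E d)‖ ^ 2) / 2) := by
    intro x
    rw [Finset.prod_mul_distrib, ← Real.exp_sum, EuclideanSpace.norm_sq_eq]
    congr 1
    · simp [pow_ite]
    · congr 1
      rw [← Finset.sum_div, ← Finset.sum_neg_distrib]
      simp
  simp_rw [hl] at h
  rw [h, ← Finset.mul_prod_erase _ _ (Finset.mem_univ (0 : Fin d))]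
  rw [Finset.prod_congr rfl (g := fun _ => 2 * gaussMoment 0)]
  · rw [if_pos rfl, integral_even_pow_mul_gauss]
    obtain ⟨e, rfl⟩ : ∃ e, d = e + 1 := ⟨d - 1, by have := NeZero.pos d; omega⟩
    simp
    ring
  · intro i hi
    rw [if_neg (Finset.ne_of_mem_erase hi)]
    exact integral_even_pow_mul_gauss 0

/-- Even moments of a coordinate of a uniform point of the sphere. -/
def coordMoment (d k : ℕ) [NeZero d] : ℝ := ∫ c, (c 0) ^ (2 * k) ∂(uniformSphere d)

/-- Both sides are the integral of `x₀^(2k) exp (-‖x‖²/2)`: the left in polar coordinates, the right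
by Fubini. -/
lemma coordMoment_mul {d : ℕ} [NeZero d] (k : ℕ) :
    coordMoment d k * ((volume : Measure (E d)).toSphere.real univ * gaussMoment (d - 1 + 2 * k)) =
      2 ^ d * gaussMoment 0 ^ (d - 1) * gaussMoment (2 * k) := by
  have hσ := toSphere_univ_ne_zero (d := d)
  have h := integral_mul_radial (d := d) (fun x => x 0 ^ (2 * k))
    (fun r => r ^ (2 * k) * Real.exp (-(r ^ 2) / 2))
  have hl : ∀ x : E d, (‖x‖⁻¹ • x) 0 ^ (2 * k) *
      (‖x‖ ^ (2 * k) * Real.exp (-(‖x‖ ^ 2) / 2)) =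
      x 0 ^ (2 * k) * Real.exp (-(‖x‖ ^ 2) / 2) := by
    intro x
    rcases eq_or_ne x 0 with rfl | hx
    · rcases eq_or_ne k 0 with rfl | hk <;> simp [*]
    · have : ‖x‖ ≠ 0 := norm_ne_zero_iff.2 hx
      simp only [PiLp.smul_apply, smul_eq_mul]
      rw [mul_pow, inv_pow]
      field_simp
  simp_rw [hl] at h
  rw [integral_coord_pow_mul_gauss] at h
  rw [h, coordMoment, integral_uniformSphere, gaussMoment]
  have : ∀ r : ℝ, r ^ (d - 1 + 2 * k) * Real.exp (-(r ^ 2) / 2) =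
      r ^ (d - 1) * (r ^ (2 * k) * Real.exp (-(r ^ 2) / 2)) := fun r => by rw [pow_add]; ring
  simp_rw [this]
  field_simp

lemma coordMoment_zero {d : ℕ} [NeZero d] : coordMoment d 0 = 1 := by simp [coordMoment]

/-- Comparing the previous identity at `k` and `k + 1` cancels the surface area, which is never
computed. -/
lemma coordMoment_succ {d : ℕ} [NeZero d] (k : ℕ) :
    coordMoment d (k + 1) * (d + 2 * k) = coordMoment d k * (2 * k + 1) := by
  have hσ := toSphere_univ_ne_zero (d := d)
  have h0 := coordMoment_mul (d := d) k
  have h1 := coordMoment_mul (d := d) (k + 1)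
  have e1 : d - 1 + 2 * (k + 1) = (d - 1 + 2 * k) + 2 := by ring
  have e2 : 2 * (k + 1) = 2 * k + 2 := by ring
  have e3 : ((d - 1 : ℕ) : ℝ) = d - 1 := by
    have := NeZero.one_le (n := d)
    push_cast [this]; rfl
  rw [e1, e2, gaussMoment_add_two, gaussMoment_add_two] at h1
  push_cast [e3] at h1
  have hg := (gaussMoment_pos (d - 1 + 2 * k)).ne'
  apply mul_right_cancel₀ (mul_ne_zero hσ hg)
  linear_combination h1 - (2 * k + 1) * h0

/-! ### The moment generating function of the sphere -/

lemma integrable_uniformSphere {d : ℕ} [NeZero d] {f : E d → ℝ} (hf : Continuous f) :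
    Integrable f (uniformSphere d) := by
  have hemb : MeasurableEmbedding (Subtype.val : sphere (0 : E d) 1 → E d) :=
    MeasurableEmbedding.subtype_coe isClosed_sphere.measurableSet
  rw [uniformSphere, hemb.integrable_map_iff]
  refine Integrable.smul_measure ?_
    (ENNReal.inv_ne_top.2 (ENNReal.toReal_ne_zero.1 toSphere_univ_ne_zero).1)
  exact (hf.comp continuous_subtype_val).integrable_of_hasCompactSupport
    (HasCompactSupport.of_compactSpace _)

lemma integral_exp_inner_eq_coord {d : ℕ} [NeZero d] (w : E d) :
    ∫ c, Real.exp (inner ℝ w c) ∂(uniformSphere d) =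
      ∫ c, Real.exp (‖w‖ * c 0) ∂(uniformSphere d) := by
  rw [integral_uniformSphere_inner_congr (u := w) (w := EuclideanSpace.single 0 ‖w‖) (by simp)
    Real.exp]
  simp [EuclideanSpace.inner_single_left]

/-- The symmetry `c ↦ -c` removes the odd part, so only even moments enter. -/
lemma integral_exp_coord_eq_cosh {d : ℕ} [NeZero d] (t : ℝ) :
    ∫ c : E d, Real.exp (t * c 0) ∂(uniformSphere d) =
      ∫ c : E d, Real.cosh (t * c 0) ∂(uniformSphere d) := by
  have h := integral_uniformSphere_comp (LinearIsometryEquiv.neg ℝ)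
    (fun c : E d => Real.exp (t * c 0))
  simp only [LinearIsometryEquiv.coe_neg, PiLp.neg_apply, mul_neg] at h
  simp_rw [Real.cosh_eq]
  rw [integral_div, integral_add (integrable_uniformSphere (by fun_prop))
    (integrable_uniformSphere (by fun_prop)), h]
  ring

lemma hasSum_integral_exp_coord {d : ℕ} [NeZero d] (t : ℝ) :
    HasSum (fun k : ℕ => t ^ (2 * k) / (2 * k).factorial * coordMoment d k)
      (∫ c : E d, Real.exp (t * c 0) ∂(uniformSphere d)) := by
  rw [integral_exp_coord_eq_cosh]
  have hint : ∀ k : ℕ, Integrable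
      (fun c : E d => (t * c 0) ^ (2 * k) / ((2 * k).factorial : ℝ)) (uniformSphere d) :=
    fun k => integrable_uniformSphere (by fun_prop)
  have h := hasSum_integral_of_summable_integral_norm hint ?_
  · simp_rw [← Real.cosh_eq_tsum] at h
    convert! h using 2 with k
    simp_rw [mul_pow, mul_div_right_comm]
    rw [integral_const_mul, coordMoment]
  -- On the sphere `|c 0| ≤ 1`, so the `cosh t` series dominates.
  · refine Summable.of_nonneg_of_le (fun k => integral_nonneg fun c => norm_nonneg _)
      (fun k => ?_) (Real.hasSum_cosh t).summable
    have : ∀ᵐ c : E d ∂(uniformSphere d),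
        ‖(t * c 0) ^ (2 * k) / ((2 * k).factorial : ℝ)‖ ≤ t ^ (2 * k) / (2 * k).factorial := by
      filter_upwards [ae_norm_eq_one_uniformSphere d] with c hc
      have h0 : ‖c 0‖ ≤ 1 := hc ▸ PiLp.norm_apply_le c 0
      rw [Real.norm_of_nonneg (by rw [pow_mul]; positivity), mul_pow]
      gcongr
      have h1 : c 0 ^ (2 * k) ≤ 1 := by
        rw [pow_mul]
        exact pow_le_one₀ (sq_nonneg _) ((sq_le_one_iff_abs_le_one _).2 h0)
      have h2 : 0 ≤ t ^ (2 * k) := by rw [pow_mul]; positivity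
      nlinarith
    calc _ ≤ ∫ _ : E d, t ^ (2 * k) / (2 * k).factorial ∂(uniformSphere d) :=
          integral_mono_ae (hint k).norm (integrable_const _) this
      _ = _ := by simp

/-- The moments compared with those of a centred Gaussian of variance `1 / d`. -/
lemma coordMoment_bounds {d : ℕ} [NeZero d] (k : ℕ) :
    coordMoment d k / (2 * k).factorial ≤ (1 / (2 * d) : ℝ) ^ k / k.factorial ∧
    (1 / (2 * d) : ℝ) ^ k / k.factorial * (1 - k * (k - 1) / d) ≤
      coordMoment d k / (2 * k).factorial := by
  have hd : (0 : ℝ) < d := by exact_mod_cast NeZero.pos d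
  induction k with
  | zero => simp [coordMoment_zero]
  | succ k ih =>
    have hm : coordMoment d (k + 1) / (2 * (k + 1)).factorial =
        coordMoment d k / (2 * k).factorial / (2 * (k + 1) * (d + 2 * k)) := by
      have := coordMoment_succ (d := d) k
      have e : (2 * (k + 1)).factorial = (2 * k + 2) * ((2 * k + 1) * (2 * k).factorial) := by
        rw [show 2 * (k + 1) = 2 * k + 1 + 1 by ring, Nat.factorial_succ, Nat.factorial_succ]
      have hf : ((2 * k).factorial : ℝ) ≠ 0 := by positivity
      rw [e]
      push_cast
      field_simp
      linear_combination this
    have hb : (1 / (2 * d) : ℝ) ^ (k + 1) / (k + 1).factorial =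
        (1 / (2 * d) : ℝ) ^ k / k.factorial / (2 * (k + 1) * d) := by
      rw [Nat.factorial_succ, pow_succ]
      push_cast
      field_simp
    have hb0 : 0 ≤ (1 / (2 * d) : ℝ) ^ k / k.factorial := by positivity
    rw [hm, hb]
    set A := coordMoment d k / (2 * k).factorial
    set B := (1 / (2 * d) : ℝ) ^ k / k.factorial
    obtain ⟨h1, h2⟩ := ih
    constructor
    · gcongr
      linarith [Nat.cast_nonneg (α := ℝ) k]
    · calc B / (2 * (k + 1) * d) * (1 - (k + 1 : ℕ) * ((k + 1 : ℕ) - 1) / d)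
          ≤ B * (1 - k * (k - 1) / d) / (2 * (k + 1) * (d + 2 * k)) := by
            rw [div_mul_eq_mul_div, div_le_div_iff₀ (by positivity) (by positivity)]
            push_cast
            -- The induction step reduces to this inequality, which needs no sign for either
            -- bracket.
            have : (1 - (k + 1 : ℝ) * (k + 1 - 1) / d) * (d + 2 * k) ≤
                (1 - k * (k - 1) / d) * d := by
              have hk : (0 : ℝ) ≤ k := Nat.cast_nonneg k
              have : (1 - k * (k - 1) / d) * d - (1 - (k + 1 : ℝ) * (k + 1 - 1) / d) * (d + 2 * k)
                = 2 * k ^ 2 * (k + 1) / d := by field_simp; ring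
              have h : 0 ≤ 2 * (k : ℝ) ^ 2 * (k + 1) / d := by positivity
              linarith
            have h3 : 0 ≤ B * (2 * (k + 1)) := by positivity
            nlinarith [mul_le_mul_of_nonneg_left this h3]
        _ ≤ _ := by gcongr

/-- The moment generating function of the uniform distribution on the sphere is dominated by that
of a Gaussian of covariance `1 / d`, up to a relative error of order `1 / d`. -/
lemma integral_exp_inner_bounds {d : ℕ} [NeZero d] (w : E d) :
    ∫ c, Real.exp (inner ℝ w c) ∂(uniformSphere d) ≤ Real.exp (‖w‖ ^ 2 / (2 * d)) ∧
    Real.exp (‖w‖ ^ 2 / (2 * d)) * (1 - (‖w‖ ^ 2 / (2 * d)) ^ 2 / d) ≤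
      ∫ c, Real.exp (inner ℝ w c) ∂(uniformSphere d) := by
  rw [integral_exp_inner_eq_coord]
  have hM := hasSum_integral_exp_coord (d := d) ‖w‖
  set s := ‖w‖ ^ 2 / (2 * d) with hs
  have hexp : HasSum (fun k : ℕ => s ^ k / k.factorial) (Real.exp s) := by
    have := NormedSpace.expSeries_div_hasSum_exp s
    rwa [← Real.exp_eq_exp_ℝ] at this
  -- The factor `k(k-1)` kills the first two terms and shifts the exponential series by two.
  have hshift : HasSum (fun k : ℕ => s ^ k / k.factorial * (k * (k - 1) / d))
      (s ^ 2 / d * Real.exp s) := by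
    rw [← hasSum_nat_add_iff' 2]
    simp only [Finset.sum_range_succ, Finset.sum_range_zero]
    norm_num
    convert! hexp.mul_left (s ^ 2 / d) using 2 with k
    rw [show k + 2 = k + 1 + 1 by ring, Nat.factorial_succ, Nat.factorial_succ]
    push_cast
    field_simp
    ring
  have hterm : ∀ k : ℕ, ‖w‖ ^ (2 * k) / (2 * k).factorial * coordMoment d k =
      ‖w‖ ^ (2 * k) * (coordMoment d k / (2 * k).factorial) := fun k => by ring
  have hpow : ∀ k : ℕ, ‖w‖ ^ (2 * k) * ((1 / (2 * d) : ℝ) ^ k / k.factorial) =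
      s ^ k / k.factorial := fun k => by
    rw [hs, div_eq_mul_one_div (‖w‖ ^ 2), mul_pow, pow_mul]; ring
  constructor
  · refine hasSum_le (fun k => ?_) hM hexp
    rw [hterm, ← hpow]
    exact mul_le_mul_of_nonneg_left (coordMoment_bounds k).1 (by positivity)
  · have h := hexp.sub hshift
    rw [show Real.exp s * (1 - s ^ 2 / d) = Real.exp s - s ^ 2 / d * Real.exp s by ring]
    refine hasSum_le (fun k => ?_) h hM
    rw [hterm, ← mul_one_sub, ← hpow, mul_assoc]
    exact mul_le_mul_of_nonneg_left (coordMoment_bounds k).2 (by positivity)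

lemma one_le_integral_exp_inner {d : ℕ} [NeZero d] (w : E d) :
    1 ≤ ∫ c, Real.exp (inner ℝ w c) ∂(uniformSphere d) := by
  rw [integral_exp_inner_eq_coord, integral_exp_coord_eq_cosh]
  calc (1 : ℝ) = ∫ _ : E d, (1 : ℝ) ∂(uniformSphere d) := by simp
    _ ≤ _ := integral_mono (integrable_const _)
        (integrable_uniformSphere (Real.continuous_cosh.comp (by fun_prop)))
        fun c => Real.one_le_cosh _

/-- The logarithm of the moment generating function of the sphere is the Gaussian one up to
`O(1 / d)`. -/
lemma abs_log_integral_exp_inner_sub_le {d : ℕ} [NeZero d] (w : E d) {s₀ : ℝ}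
    (hs : ‖w‖ ^ 2 / (2 * d) ≤ s₀) :
    |Real.log (∫ c, Real.exp (inner ℝ w c) ∂(uniformSphere d)) - ‖w‖ ^ 2 / (2 * d)| ≤
      Real.exp s₀ * s₀ ^ 2 / d := by
  have hd : (0 : ℝ) < d := by exact_mod_cast NeZero.pos d
  obtain ⟨h1, h2⟩ := integral_exp_inner_bounds w
  have h3 := one_le_integral_exp_inner w
  set M := ∫ c, Real.exp (inner ℝ w c) ∂(uniformSphere d)
  set s := ‖w‖ ^ 2 / (2 * d) with hs'
  have hs0 : 0 ≤ s := by positivity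
  have hM : 0 < M := by linarith
  have hle : Real.log M ≤ s := (Real.log_le_iff_le_exp hM).2 h1
  rw [abs_sub_comm, abs_of_nonneg (by linarith)]
  have h4 : s - Real.log M = Real.log (Real.exp s / M) := by
    rw [Real.log_div (Real.exp_pos _).ne' hM.ne', Real.log_exp]
  -- Since `M ≥ 1`, the division by `M` can be dropped, and `s²/d` need not be small.
  have h5 : Real.exp s / M - 1 ≤ Real.exp s * s ^ 2 / d := by
    have e : Real.exp s / M - 1 = (Real.exp s - M) / M := by field_simp
    rw [e]
    have hnn : 0 ≤ Real.exp s - M := by linarith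
    calc (Real.exp s - M) / M ≤ Real.exp s - M := div_le_self hnn h3
      _ ≤ _ := by
        have : Real.exp s * (1 - s ^ 2 / d) = Real.exp s - Real.exp s * s ^ 2 / d := by ring
        linarith
  calc s - Real.log M ≤ Real.exp s / M - 1 := by
        rw [h4]; exact Real.log_le_sub_one_of_pos (by positivity)
    _ ≤ _ := h5
    _ ≤ _ := by gcongr

/-! ### Scores, partition functions and orthogonal matrices -/

lemma score_eq_inner_transpose {d : ℕ} (R : Matrix (Fin d) (Fin d) ℝ) (v c : E d) :
    score R v c = inner ℝ (Matrix.toEuclideanLin R.transpose v) c := by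
  rw [score, ← Matrix.conjTranspose_eq_transpose_of_trivial,
    Matrix.toEuclideanLin_conjTranspose_eq_adjoint, LinearMap.adjoint_inner_left]

lemma continuous_score {d : ℕ} (R : Matrix (Fin d) (Fin d) ℝ) (v : E d) :
    Continuous (score R v) := by
  simp_rw [funext (score_eq_inner_transpose R v)]
  fun_prop

lemma continuous_partitionFn {n d : ℕ} (v : Fin n → E d) (R : Matrix (Fin d) (Fin d) ℝ) :
    Continuous (partitionFn v R) := by
  have := fun i => continuous_score R (v i)
  unfold partitionFn
  fun_prop

lemma partitionFn_pos {n d : ℕ} (v : Fin n → E d) (R : Matrix (Fin d) (Fin d) ℝ) (c : E d)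
    (h : Fin n) : 0 < partitionFn v R c :=
  Finset.sum_pos (fun _ _ => Real.exp_pos _) ⟨h, Finset.mem_univ _⟩

lemma entityProb_pos {n d : ℕ} (v : Fin n → E d) (R : Matrix (Fin d) (Fin d) ℝ) (c : E d)
    (h : Fin n) : 0 < entityProb v R c h :=
  div_pos (Real.exp_pos _) (partitionFn_pos v R c h)

lemma entityProb_le_one {n d : ℕ} (v : Fin n → E d) (R : Matrix (Fin d) (Fin d) ℝ) (c : E d)
    (h : Fin n) : entityProb v R c h ≤ 1 := by
  rw [entityProb, div_le_one (partitionFn_pos v R c h)]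
  exact Finset.single_le_sum (f := fun i => Real.exp (score R (v i) c))
    (fun _ _ => (Real.exp_pos _).le) (Finset.mem_univ h)

lemma continuous_entityProb {n d : ℕ} (v : Fin n → E d) (R : Matrix (Fin d) (Fin d) ℝ)
    (h : Fin n) : Continuous (fun c => entityProb v R c h) :=
  (Real.continuous_exp.comp (continuous_score R (v h))).div (continuous_partitionFn v R)
    fun c => (partitionFn_pos v R c h).ne'

lemma exists_linearIsometryEquiv_of_mem_orthogonalGroup {d : ℕ} {R : Matrix (Fin d) (Fin d) ℝ}
    (hR : R ∈ Matrix.orthogonalGroup (Fin d) ℝ) :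
    ∃ f : E d ≃ₗᵢ[ℝ] E d, ∀ x, f x = Matrix.toEuclideanLin R x := by
  have hn : ∀ x : E d, ‖Matrix.toEuclideanLin R x‖ = ‖x‖ := by
    intro x
    rw [norm_eq_sqrt_real_inner, norm_eq_sqrt_real_inner]
    congr 1
    rw [← LinearMap.adjoint_inner_left, ← Matrix.toEuclideanLin_conjTranspose_eq_adjoint,
      Matrix.toLpLin_apply, Matrix.toLpLin_apply]
    have h1 : R.transpose * R = 1 := (Matrix.mem_unitaryGroup_iff').1 hR
    simp [Matrix.mulVec_mulVec, h1]
  exact ⟨(⟨Matrix.toEuclideanLin R, hn⟩ : E d →ₗᵢ[ℝ] E d).toLinearIsometryEquiv rfl, fun _ => rfl⟩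

lemma norm_toEuclideanLin_transpose {d : ℕ} {R : Matrix (Fin d) (Fin d) ℝ}
    (hR : R ∈ Matrix.orthogonalGroup (Fin d) ℝ) (x : E d) :
    ‖Matrix.toEuclideanLin R.transpose x‖ = ‖x‖ := by
  have hR' : R.transpose ∈ Matrix.orthogonalGroup (Fin d) ℝ := Unitary.star_mem hR
  obtain ⟨f, hf⟩ := exists_linearIsometryEquiv_of_mem_orthogonalGroup hR'
  rw [← hf, f.norm_map]

/-- Concentration of the partition function does not depend on the orthogonal matrix. -/
lemma Concentrated.congr_orthogonal {n d : ℕ} {v : Fin n → E d}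
    {R₁ R₂ : Matrix (Fin d) (Fin d) ℝ} {Z εz δ : ℝ}
    (h : Concentrated v R₁ Z εz δ) (h₁ : R₁ ∈ Matrix.orthogonalGroup (Fin d) ℝ)
    (h₂ : R₂ ∈ Matrix.orthogonalGroup (Fin d) ℝ) : Concentrated v R₂ Z εz δ := by
  obtain ⟨f₁, hf₁⟩ := exists_linearIsometryEquiv_of_mem_orthogonalGroup h₁
  obtain ⟨f₂, hf₂⟩ := exists_linearIsometryEquiv_of_mem_orthogonalGroup h₂
  -- `g = R₁⁻¹ R₂` carries one partition function to the other and preserves the uniform law.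
  let g := f₂.trans f₁.symm
  have hZ : ∀ c, partitionFn v R₂ c = partitionFn v R₁ (g c) := by
    intro c
    simp [partitionFn, score, g, ← hf₁, ← hf₂]
  have hms : MeasurableSet
      {c | (1 - εz) * Z ≤ partitionFn v R₁ c ∧ partitionFn v R₁ c ≤ (1 + εz) * Z} :=
    (measurableSet_le measurable_const (continuous_partitionFn v R₁).measurable).inter
      (measurableSet_le (continuous_partitionFn v R₁).measurable measurable_const)
  unfold Concentrated at h ⊢
  rw [← map_uniformSphere g, map_measureReal_apply g.continuous.measurable hms] at h
  simp only [hZ]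
  exact h

/-! ### Fourth moments of the model and the size of `Z` -/

/-- Convexity of `y ↦ y⁻¹ ^ 4`. -/
lemma card_div_sum_pow_four_le {n : ℕ} (hn : 0 < n) {y : Fin n → ℝ} (hy : ∀ i, 0 < y i) :
    (n / ∑ i, y i) ^ 4 ≤ (1 / n) * ∑ i, (y i)⁻¹ ^ 4 := by
  have hn' : (0 : ℝ) < n := by exact_mod_cast hn
  have hS : 0 < ∑ i, y i := Finset.sum_pos (fun i _ => hy i) ⟨⟨0, hn⟩, Finset.mem_univ _⟩
  set r := n / ∑ i, y i with hr
  have hr0 : 0 < r := by positivity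
  -- The tangent line `5 - 4z` of `z⁻⁴` at `z = 1`, with `z` equal to `y i` divided by the mean.
  have key : ∀ i, r ^ 4 * (5 - 4 * (r * y i)) ≤ (y i)⁻¹ ^ 4 := by
    intro i
    have hyi := hy i
    set z := r * y i with hz
    have hz0 : 0 < z := by positivity
    have e : (y i)⁻¹ ^ 4 = r ^ 4 * z⁻¹ ^ 4 := by rw [hz]; field_simp
    rw [e]
    refine mul_le_mul_of_nonneg_left ?_ (by positivity)
    have hz4 : 0 < z ^ 4 := by positivity
    rw [inv_pow, ← one_div, le_div_iff₀ hz4]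
    nlinarith [mul_nonneg (sq_nonneg (z - 1))
      (by positivity : 0 ≤ 4 * z ^ 3 + 3 * z ^ 2 + 2 * z + 1)]
  have hsum := Finset.sum_le_sum fun i (_ : i ∈ Finset.univ) => key i
  rw [← Finset.mul_sum, Finset.sum_sub_distrib, ← Finset.mul_sum, ← Finset.mul_sum] at hsum
  have e : r * ∑ i, y i = n := by rw [hr]; field_simp
  rw [e] at hsum
  simp only [Finset.sum_const, Finset.card_univ, Fintype.card_fin, nsmul_eq_mul] at hsum
  rw [one_div, ← div_eq_inv_mul, le_div_iff₀ hn']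
  linarith

lemma integral_exp_inner_le {d : ℕ} [NeZero d] {w : E d} {b : ℝ} (hw : ‖w‖ ≤ b * √d) :
    ∫ c, Real.exp (inner ℝ w c) ∂(uniformSphere d) ≤ Real.exp (b ^ 2 / 2) := by
  have hd : (0 : ℝ) < d := by exact_mod_cast NeZero.pos d
  refine (integral_exp_inner_bounds w).1.trans (Real.exp_le_exp.2 ?_)
  have : ‖w‖ ^ 2 ≤ b ^ 2 * d := by
    calc ‖w‖ ^ 2 ≤ (b * √d) ^ 2 := by gcongr
      _ = _ := by rw [mul_pow, Real.sq_sqrt hd.le]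
  rw [div_le_div_iff₀ (by positivity) two_pos]
  linarith

/-- `n p(h | R, c)` is the reciprocal of the mean of `exp ⟨Rᵀ(v i - v h), c⟩`. Jensen for `y⁻⁴`
turns its fourth power into a mean of `exp ⟨w i, c⟩`, where `‖w i‖ ≤ 8κ√d`. -/
lemma integral_card_mul_entityProb_pow_four_le {n d : ℕ} [NeZero d] {v : Fin n → E d} {κ : ℝ}
    (hv : ∀ i, ‖v i‖ ≤ κ * √d) {R : Matrix (Fin d) (Fin d) ℝ}
    (hR : R ∈ Matrix.orthogonalGroup (Fin d) ℝ) (h : Fin n) :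
    ∫ c, (n * entityProb v R c h) ^ 4 ∂(uniformSphere d) ≤ Real.exp (32 * κ ^ 2) := by
  have hn : 0 < n := h.pos
  have hn' : (0 : ℝ) < n := by exact_mod_cast hn
  let w : Fin n → E d := fun i => (4 : ℝ) • Matrix.toEuclideanLin R.transpose (v h - v i)
  have hw : ∀ i, ‖w i‖ ≤ (8 * κ) * √d := by
    intro i
    simp only [w, norm_smul, norm_toEuclideanLin_transpose hR, Real.norm_ofNat]
    linarith [norm_sub_le (v h) (v i), hv h, hv i]
  have hpt : ∀ c, (n * entityProb v R c h) ^ 4 ≤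
      (1 / n) * ∑ i, Real.exp (inner ℝ (w i) c) := by
    intro c
    have h1 := card_div_sum_pow_four_le hn (y := fun i => Real.exp (score R (v i) c))
      fun i => Real.exp_pos _
    calc (n * entityProb v R c h) ^ 4 = Real.exp (score R (v h) c) ^ 4 *
          (n / ∑ i, Real.exp (score R (v i) c)) ^ 4 := by
            rw [entityProb, partitionFn]; ring
      _ ≤ Real.exp (score R (v h) c) ^ 4 *
          ((1 / n) * ∑ i, (Real.exp (score R (v i) c))⁻¹ ^ 4) := by gcongr
      _ = _ := by
        rw [mul_left_comm, Finset.mul_sum]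
        congr 1
        refine Finset.sum_congr rfl fun i _ => ?_
        rw [← Real.exp_neg, ← Real.exp_nat_mul, ← Real.exp_nat_mul, ← Real.exp_add,
          score_eq_inner_transpose, score_eq_inner_transpose, real_inner_smul_left, map_sub,
          inner_sub_left]
        congr 1
        push_cast
        ring
  have hi : ∀ i, Integrable (fun c => Real.exp (inner ℝ (w i) c)) (uniformSphere d) :=
    fun i => integrable_uniformSphere (by fun_prop)
  have hc := continuous_entityProb v R h
  calc ∫ c, (n * entityProb v R c h) ^ 4 ∂(uniformSphere d)
      ≤ ∫ c, (1 / n) * ∑ i, Real.exp (inner ℝ (w i) c) ∂(uniformSphere d) :=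
        integral_mono (integrable_uniformSphere (by fun_prop))
          (integrable_uniformSphere (by fun_prop)) hpt
    _ = (1 / n) * ∑ i, ∫ c, Real.exp (inner ℝ (w i) c) ∂(uniformSphere d) := by
        rw [integral_const_mul, integral_finsetSum _ fun i _ => hi i]
    _ ≤ (1 / n) * ∑ _i : Fin n, Real.exp ((8 * κ) ^ 2 / 2) := by
        gcongr with i
        exact integral_exp_inner_le (hw i)
    _ = _ := by
        simp only [Finset.sum_const, Finset.card_univ, Fintype.card_fin, nsmul_eq_mul]
        rw [show (8 * κ) ^ 2 / 2 = 32 * κ ^ 2 by ring]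
        field_simp

/-- A value around which the partition function concentrates is of order at most `n`. -/
lemma Concentrated.le_card_mul {n d : ℕ} [NeZero d] {v : Fin n → E d} {κ : ℝ}
    (hv : ∀ i, ‖v i‖ ≤ κ * √d) {R : Matrix (Fin d) (Fin d) ℝ}
    (hR : R ∈ Matrix.orthogonalGroup (Fin d) ℝ) {Z εz δ : ℝ} (hZ : 0 < Z) (hε : εz ≤ 1 / 2)
    (hδ : δ ≤ 1 / 2) (h : Concentrated v R Z εz δ) : Z ≤ 4 * n * Real.exp (κ ^ 2 / 2) := by
  have hint := integrable_uniformSphere (continuous_partitionFn v R)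
  have h1 : ∫ c, partitionFn v R c ∂(uniformSphere d) ≤ n * Real.exp (κ ^ 2 / 2) := by
    simp only [partitionFn, score_eq_inner_transpose]
    rw [integral_finsetSum _ fun i _ => integrable_uniformSphere (by fun_prop)]
    calc _ ≤ ∑ _i : Fin n, Real.exp (κ ^ 2 / 2) := by
          gcongr with i
          exact integral_exp_inner_le (by rw [norm_toEuclideanLin_transpose hR]; exact hv i)
      _ = _ := by simp
  -- Markov's inequality at the level `(1 - εz) Z`, which is exceeded with probability at least
  -- `1/2`.
  have h2 := mul_meas_ge_le_integral_of_nonneg (Filter.Eventually.of_forall fun c =>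
    Finset.sum_nonneg fun i _ => (Real.exp_pos (score R (v i) c)).le) hint ((1 - εz) * Z)
  have h3 : 1 / 2 ≤ (uniformSphere d).real {c | (1 - εz) * Z ≤ partitionFn v R c} := by
    unfold Concentrated at h
    calc (1 / 2 : ℝ) ≤ 1 - δ := by linarith
      _ ≤ _ := h
      _ ≤ _ := measureReal_mono (fun c hc => hc.1) (measure_ne_top _ _)
  have h4 : (1 / 2) * Z ≤ (1 - εz) * Z := by gcongr; linarith
  have h5 : (1 / 2) * Z * (1 / 2) ≤
      (1 - εz) * Z * (uniformSphere d).real {c | (1 - εz) * Z ≤ partitionFn v R c} :=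
    mul_le_mul h4 h3 (by norm_num) (by linarith)
  linarith [h5.trans (h2.trans h1)]

/-! ### Expectations with an exceptional event -/

section TwoFunctions

variable {Ω : Type*} [MeasurableSpace Ω] {P : Measure Ω} [IsProbabilityMeasure P]
  {X Y G : Ω → ℝ} {B : Set Ω} {ρ L Q : ℝ}

/-- If `X Y ≤ L G` off a set `B` of probability at most `2 ρ²`, then `𝔼[X Y]` is at most `L 𝔼[G]`
up to a term of order `ρ` controlled by the fourth moments. -/
lemma integral_mul_le_of_le_off (hXY : Integrable (fun ω => X ω * Y ω) P)
    {m : ℝ} (hm : 0 < m)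
    (hX : Integrable (fun ω => (m * X ω) ^ 4) P) (hY : Integrable (fun ω => (m * Y ω) ^ 4) P)
    (hG : Integrable G P) (hG0 : ∀ ω, 0 ≤ G ω) (hB : MeasurableSet B) (hρ : 0 < ρ)
    (hPB : P.real B ≤ 2 * ρ ^ 2) (hL : 0 ≤ L) (hgood : ∀ᵐ ω ∂P, ω ∉ B → X ω * Y ω ≤ L * G ω)
    (hXQ : ∫ ω, (m * X ω) ^ 4 ∂P ≤ Q) (hYQ : ∫ ω, (m * Y ω) ^ 4 ∂P ≤ Q) :
    ∫ ω, X ω * Y ω ∂P ≤ L * (∫ ω, G ω ∂P) + ρ * (Q / 2 + 1) / m ^ 2 := by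
  have hb : Integrable (B.indicator fun _ => (1 : ℝ)) P := (integrable_const 1).indicator hB
  have hpt : ∀ᵐ ω ∂P, X ω * Y ω ≤ L * G ω + (1 / m ^ 2) * ((ρ / 4) * ((m * X ω) ^ 4 +
      (m * Y ω) ^ 4) + (1 / (2 * ρ)) * B.indicator (fun _ => (1 : ℝ)) ω) := by
    filter_upwards [hgood] with ω hω
    by_cases hωB : ω ∈ B
    · rw [indicator_of_mem hωB]
      have h0 : 0 ≤ L * G ω := mul_nonneg hL (hG0 ω)
      set x := m * X ω with hx
      set y := m * Y ω with hy
      -- A pointwise substitute for Hölder: the weights `ρ` and `1/ρ` balance because `B` has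
      -- probability at most `2ρ²`.
      have h1 : x * y ≤ ρ / 4 * (x ^ 4 + y ^ 4) + 1 / (2 * ρ) * 1 := by
        have e : ρ / 4 * (x ^ 4 + y ^ 4) + 1 / (2 * ρ) * 1 - x * y =
            ρ / 4 * (x ^ 2 - y ^ 2) ^ 2 + (1 / (2 * ρ)) * (ρ * (x * y) - 1) ^ 2 := by
          field_simp; ring
        have : 0 ≤ ρ / 4 * (x ^ 2 - y ^ 2) ^ 2 + (1 / (2 * ρ)) * (ρ * (x * y) - 1) ^ 2 := by
          positivity
        linarith
      have h2 : X ω * Y ω = (1 / m ^ 2) * (x * y) := by rw [hx, hy]; field_simp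
      rw [h2]
      have := mul_le_mul_of_nonneg_left h1 (by positivity : 0 ≤ 1 / m ^ 2)
      linarith
    · rw [indicator_of_notMem hωB]
      have : 0 ≤ (1 / m ^ 2) * ((ρ / 4) * ((m * X ω) ^ 4 + (m * Y ω) ^ 4) + 1 / (2 * ρ) * 0) := by
        positivity
      linarith [hω hωB]
  have hI1 : Integrable (fun ω => (ρ / 4) * ((m * X ω) ^ 4 + (m * Y ω) ^ 4)) P :=
    (hX.add hY).const_mul _
  have hI2 := hb.const_mul (1 / (2 * ρ))
  refine (integral_mono_ae hXY
    ((hG.const_mul L).add ((hI1.add hI2).const_mul (1 / m ^ 2))) hpt).trans ?_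
  have hs := integral_add (hG.const_mul L) ((hI1.add hI2).const_mul (1 / m ^ 2))
  have ha := integral_add hI1 hI2
  simp only [Pi.add_apply] at hs ha ⊢
  rw [hs, integral_const_mul, integral_const_mul, ha, integral_const_mul, integral_const_mul,
    integral_add hX hY, integral_indicator_const _ hB, smul_eq_mul, mul_one]
  have h1 : 1 / (2 * ρ) * P.real B ≤ ρ := by
    calc 1 / (2 * ρ) * P.real B ≤ 1 / (2 * ρ) * (2 * ρ ^ 2) := by gcongr
      _ = ρ := by field_simp
  have h2 : ρ / 4 * ((∫ ω, (m * X ω) ^ 4 ∂P) + ∫ ω, (m * Y ω) ^ 4 ∂P) ≤ ρ / 4 * (Q + Q) := by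
    gcongr
  have h3 : ρ * (Q / 2 + 1) / m ^ 2 = 1 / m ^ 2 * (ρ / 4 * (Q + Q) + ρ) := by ring
  rw [h3]
  gcongr

/-- If `L G ≤ X Y` off a set `B` of probability at most `2 ρ²`, then `𝔼[X Y]` is at least `L 𝔼[G]`
up to a term of order `ρ` controlled by the second moment of `G`. -/
lemma le_integral_mul_of_le_off (hXY : Integrable (fun ω => X ω * Y ω) P)
    (hX0 : ∀ ω, 0 ≤ X ω) (hY0 : ∀ ω, 0 ≤ Y ω)
    (hG : Integrable G P) (hG2 : Integrable (fun ω => G ω ^ 2) P) (hB : MeasurableSet B)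
    (hρ : 0 < ρ) (hPB : P.real B ≤ 2 * ρ ^ 2) (hL : 0 ≤ L)
    (hgood : ∀ᵐ ω ∂P, ω ∉ B → L * G ω ≤ X ω * Y ω) (hGQ : ∫ ω, G ω ^ 2 ∂P ≤ Q) :
    L * ((∫ ω, G ω ∂P) - ρ * (Q / 2 + 1)) ≤ ∫ ω, X ω * Y ω ∂P := by
  have hb : Integrable (B.indicator fun _ => (1 : ℝ)) P := (integrable_const 1).indicator hB
  have hpt : ∀ᵐ ω ∂P, L * (G ω - ((ρ / 2) * G ω ^ 2 +
      (1 / (2 * ρ)) * B.indicator (fun _ => (1 : ℝ)) ω)) ≤ X ω * Y ω := by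
    filter_upwards [hgood] with ω hω
    by_cases hωB : ω ∈ B
    · rw [indicator_of_mem hωB]
      -- On `B` the minorant is nonpositive, so nonnegativity of `X Y` suffices there.
      have e : G ω - ((ρ / 2) * G ω ^ 2 + (1 / (2 * ρ)) * 1) =
          -((1 / (2 * ρ)) * (ρ * G ω - 1) ^ 2) := by field_simp; ring
      have h1 : 0 ≤ L * ((1 / (2 * ρ)) * (ρ * G ω - 1) ^ 2) := by positivity
      rw [e]
      linarith [mul_nonneg (hX0 ω) (hY0 ω)]
    · rw [indicator_of_notMem hωB]
      have : 0 ≤ L * ((ρ / 2) * G ω ^ 2 + (1 / (2 * ρ)) * 0) := by positivity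
      linarith [hω hωB]
  have hI1 := hG2.const_mul (ρ / 2)
  have hI2 := hb.const_mul (1 / (2 * ρ))
  refine le_trans ?_ (integral_mono_ae ((hG.sub (hI1.add hI2)).const_mul L) hXY hpt)
  simp only [Pi.sub_apply, Pi.add_apply]
  rw [integral_const_mul]
  refine mul_le_mul_of_nonneg_left ?_ hL
  have hs := integral_sub hG (hI1.add hI2)
  have ha := integral_add hI1 hI2
  simp only [Pi.add_apply] at hs ha
  rw [hs, ha, integral_const_mul, integral_const_mul, integral_indicator_const _ hB, smul_eq_mul,
    mul_one]
  have h1 : 1 / (2 * ρ) * P.real B ≤ ρ := by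
    calc 1 / (2 * ρ) * P.real B ≤ 1 / (2 * ρ) * (2 * ρ ^ 2) := by gcongr
      _ = ρ := by field_simp
  have h2 : ρ / 2 * (∫ ω, G ω ^ 2 ∂P) ≤ ρ / 2 * Q := by gcongr
  linarith

end TwoFunctions

/-! ### Assembling the estimate of the logarithm -/

/-- Passing from multiplicative bounds to an additive bound on the logarithm. -/
lemma abs_log_sub_le_of_bounds {J M Z ε η x y : ℝ} (hM : 1 ≤ M) (hZ : 0 < Z) (hε0 : 0 ≤ ε)
    (hε : ε ≤ 1 / 2) (hη : 0 ≤ η) (hx0 : 0 ≤ x) (hx : x ≤ 1 / 2) (hy : 0 ≤ y)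
    (hup : J ≤ Real.exp η / ((1 - ε) * Z) ^ 2 * M + y / Z ^ 2)
    (hlo : Real.exp (-η) / ((1 + ε) * Z) ^ 2 * (M - x) ≤ J) :
    |Real.log J - (Real.log M - 2 * Real.log Z)| ≤ η + 6 * ε + y + 2 * x := by
  have hM0 : 0 < M := by linarith
  have hMx : 0 < M - x := by linarith
  have hJ : 0 < J := lt_of_lt_of_le (by positivity) hlo
  have h1ε : 0 < 1 - ε := by linarith
  rw [abs_le]
  constructor
  · have h1 := Real.log_le_log (by positivity) hlo
    rw [Real.log_mul (by positivity) hMx.ne', Real.log_div (Real.exp_pos _).ne' (by positivity),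
      Real.log_exp, Real.log_pow, Real.log_mul (by positivity) hZ.ne'] at h1
    have h2 : Real.log (1 + ε) ≤ ε := by
      have := Real.log_le_sub_one_of_pos (by linarith : 0 < 1 + ε); linarith
    have h3 : Real.log M - Real.log (M - x) ≤ 2 * x := by
      rw [← Real.log_div hM0.ne' hMx.ne']
      refine (Real.log_le_sub_one_of_pos (by positivity)).trans ?_
      rw [div_sub_one hMx.ne', div_le_iff₀ hMx]
      nlinarith
    push_cast at h1
    linarith
  · have h4 : Real.exp η / ((1 - ε) * Z) ^ 2 * M + y / Z ^ 2 ≤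
        Real.exp η * M / Z ^ 2 * (1 + 6 * ε + y) := by
      -- The slope `6` is that of the chord of `(1 - ε)⁻²` over `[0, 1/2]`.
      have hinv : 1 / (1 - ε) ^ 2 ≤ 1 + 6 * ε := by
        rw [div_le_iff₀ (by positivity)]
        nlinarith [mul_nonneg hε0 (by linarith : 0 ≤ 1 - 2 * ε), mul_nonneg hε0 hε0,
          mul_nonneg (mul_nonneg hε0 hε0) hε0]
      have hE : 1 ≤ Real.exp η := Real.one_le_exp hη
      -- This absorbs the additive error `y` into a multiplicative one.
      have hEM : 1 ≤ Real.exp η * M := by nlinarith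
      calc Real.exp η / ((1 - ε) * Z) ^ 2 * M + y / Z ^ 2
          = (Real.exp η * M * (1 / (1 - ε) ^ 2) + 1 * y) / Z ^ 2 := by field_simp
        _ ≤ (Real.exp η * M * (1 + 6 * ε) + Real.exp η * M * y) / Z ^ 2 := by gcongr
        _ = _ := by ring
    have h5 := Real.log_le_log hJ (hup.trans h4)
    rw [Real.log_mul (by positivity) (by positivity), Real.log_div (by positivity) (by positivity),
      Real.log_mul (Real.exp_pos _).ne' hM0.ne', Real.log_exp, Real.log_pow] at h5
    have h6 := Real.log_le_sub_one_of_pos (by positivity : 0 < 1 + 6 * ε + y)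
    push_cast at h5
    linarith

/-- The probability that a uniform vector leaves the concentration window. -/
lemma Concentrated.measureReal_preimage_compl_le {Ω : Type*} [MeasurableSpace Ω] {P : Measure Ω}
    {n d : ℕ} [NeZero d] {v : Fin n → E d}
    {R : Matrix (Fin d) (Fin d) ℝ} {Z εz δ : ℝ} (h : Concentrated v R Z εz δ) {c : Ω → E d}
    (hc : Measurable c) (hmap : P.map c = uniformSphere d) :
    MeasurableSet {ω | ¬ ((1 - εz) * Z ≤ partitionFn v R (c ω) ∧
      partitionFn v R (c ω) ≤ (1 + εz) * Z)} ∧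
    P.real {ω | ¬ ((1 - εz) * Z ≤ partitionFn v R (c ω) ∧
      partitionFn v R (c ω) ≤ (1 + εz) * Z)} ≤ δ := by
  have hms : MeasurableSet
      {c | (1 - εz) * Z ≤ partitionFn v R c ∧ partitionFn v R c ≤ (1 + εz) * Z} :=
    (measurableSet_le measurable_const (continuous_partitionFn v R).measurable).inter
      (measurableSet_le (continuous_partitionFn v R).measurable measurable_const)
  refine ⟨hc hms.compl, ?_⟩
  have h1 := map_measureReal_apply (μ := P) hc hms.compl
  rw [hmap, probReal_compl_eq_one_sub hms] at h1
  unfold Concentrated at h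
  refine h1.symm.le.trans ?_
  linarith

/-- Quantitative form of the estimate for `log p(h, t | R)`, for a single pair of steps. -/
lemma abs_log_jointProb_sub_le {Ω : Type*} [MeasurableSpace Ω] {P : Measure Ω}
    [IsProbabilityMeasure P] {n d : ℕ} [NeZero d] {v : Fin n → E d} {κ : ℝ} (hκ : 0 < κ)
    (hv : ∀ i, ‖v i‖ ≤ κ * √d) {R₁ R₂ : Matrix (Fin d) (Fin d) ℝ}
    (hR₁ : R₁ ∈ Matrix.orthogonalGroup (Fin d) ℝ) (hR₂ : R₂ ∈ Matrix.orthogonalGroup (Fin d) ℝ)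
    {Z εz δ ε₂ ρ A : ℝ} (hZ : 0 < Z) (hε0 : 0 ≤ εz) (hε : εz ≤ 1 / 2)
    (hρ : 0 < ρ) (hδ : δ ≤ ρ ^ 2) (hA : A = Real.exp (32 * κ ^ 2) / 2 + 1)
    (hρA : ρ * A ≤ 1 / 2)
    (h₁ : Concentrated v R₁ Z εz δ) (h₂ : Concentrated v R₂ Z εz δ) {c c' : Ω → E d}
    (hc : Measurable c) (hc' : Measurable c') (hmap : P.map c = uniformSphere d)
    (hmap' : P.map c' = uniformSphere d) (hε₂ : 0 ≤ ε₂) (hslow : ∀ᵐ ω ∂P, ‖c ω - c' ω‖ ≤ ε₂)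
    (h t : Fin n) :
    |Real.log (jointProb P v R₁ R₂ c c' h t) -
      (‖Matrix.toEuclideanLin R₁.transpose (v h) + Matrix.toEuclideanLin R₂.transpose (v t)‖ ^ 2
        / (2 * d) - 2 * Real.log Z)| ≤
      κ * √d * ε₂ + 6 * εz + 16 * Real.exp (κ ^ 2) * (ρ * A) + 2 * (ρ * A) +
        Real.exp (2 * κ ^ 2) * (2 * κ ^ 2) ^ 2 / d := by
  have hd : (0 : ℝ) < d := by exact_mod_cast NeZero.pos d
  have hn : (0 : ℝ) < n := by exact_mod_cast h.pos
  set u := Matrix.toEuclideanLin R₁.transpose (v h) with hu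
  set u' := Matrix.toEuclideanLin R₂.transpose (v t) with hu'
  set w := u + u' with hw
  have hun : ‖u‖ ≤ κ * √d := by rw [hu, norm_toEuclideanLin_transpose hR₁]; exact hv h
  have hun' : ‖u'‖ ≤ κ * √d := by rw [hu', norm_toEuclideanLin_transpose hR₂]; exact hv t
  have hwn : ‖w‖ ≤ (2 * κ) * √d := by linarith [norm_add_le u u']
  have hA1 : 1 ≤ A := by rw [hA]; linarith [Real.exp_pos (32 * κ ^ 2)]
  have hρ1 : ρ ≤ 1 / 2 := by nlinarith
  have hδ2 : δ ≤ 1 / 2 := by nlinarith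
  set η := κ * √d * ε₂ with hη
  have hη0 : 0 ≤ η := by positivity
  have hint : ∀ {f : E d → ℝ}, Continuous f → Integrable (fun ω => f (c ω)) P := fun {f} hf =>
    Integrable.comp_measurable (by rw [hmap]; exact integrable_uniformSphere hf) hc
  have hint' : ∀ {f : E d → ℝ}, Continuous f → Integrable (fun ω => f (c' ω)) P := fun {f} hf =>
    Integrable.comp_measurable (by rw [hmap']; exact integrable_uniformSphere hf) hc'
  have hval : ∀ {f : E d → ℝ}, Continuous f →
      ∫ ω, f (c ω) ∂P = ∫ x, f x ∂(uniformSphere d) := fun {f} hf => by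
    rw [← hmap, integral_map hc.aemeasurable hf.aestronglyMeasurable]
  have hval' : ∀ {f : E d → ℝ}, Continuous f →
      ∫ ω, f (c' ω) ∂P = ∫ x, f x ∂(uniformSphere d) := fun {f} hf => by
    rw [← hmap', integral_map hc'.aemeasurable hf.aestronglyMeasurable]
  have hp := continuous_entityProb v R₁ h
  have hp' := continuous_entityProb v R₂ t
  have hXY : Integrable (fun ω => entityProb v R₁ (c ω) h * entityProb v R₂ (c' ω) t) P := by
    refine Integrable.of_bound
      ((hp.measurable.comp hc).mul (hp'.measurable.comp hc')).aestronglyMeasurable 1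
      (Filter.Eventually.of_forall fun ω => ?_)
    rw [Real.norm_of_nonneg (mul_pos (entityProb_pos ..) (entityProb_pos ..)).le]
    exact mul_le_one₀ (entityProb_le_one ..) (entityProb_pos ..).le (entityProb_le_one ..)
  have hcG : Continuous fun x : E d => Real.exp (inner ℝ w x) := by fun_prop
  obtain ⟨hB₁, hPB₁⟩ := h₁.measureReal_preimage_compl_le hc hmap
  obtain ⟨hB₂, hPB₂⟩ := h₂.measureReal_preimage_compl_le hc' hmap'
  set B₁ := {ω | ¬ ((1 - εz) * Z ≤ partitionFn v R₁ (c ω) ∧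
      partitionFn v R₁ (c ω) ≤ (1 + εz) * Z)} with hB₁def
  set B₂ := {ω | ¬ ((1 - εz) * Z ≤ partitionFn v R₂ (c' ω) ∧
      partitionFn v R₂ (c' ω) ≤ (1 + εz) * Z)} with hB₂def
  have hPB : P.real (B₁ ∪ B₂) ≤ 2 * ρ ^ 2 := by
    linarith [measureReal_union_le (μ := P) B₁ B₂]
  have h1ε : 0 < (1 - εz) * Z := mul_pos (by linarith) hZ
  have h2ε : 0 < (1 + εz) * Z := mul_pos (by linarith) hZ
  -- Evaluating both scores at `c` leaves only `⟨u', c' - c⟩`, bounded by Cauchy–Schwarz.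
  have hexpo : ∀ᵐ ω ∂P, |score R₁ (v h) (c ω) + score R₂ (v t) (c' ω) - inner ℝ w (c ω)| ≤ η := by
    filter_upwards [hslow] with ω hω
    rw [score_eq_inner_transpose, score_eq_inner_transpose, ← hu, ← hu', hw, inner_add_left,
      add_sub_add_left_eq_sub, ← inner_sub_right]
    refine (abs_real_inner_le_norm _ _).trans ?_
    rw [norm_sub_rev] at hω
    rw [hη]
    gcongr
  have hprod : ∀ ω, entityProb v R₁ (c ω) h * entityProb v R₂ (c' ω) t =
      Real.exp (score R₁ (v h) (c ω) + score R₂ (v t) (c' ω)) /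
        (partitionFn v R₁ (c ω) * partitionFn v R₂ (c' ω)) := fun ω => by
    rw [entityProb, entityProb, div_mul_div_comm, Real.exp_add]
  have hgood_up : ∀ᵐ ω ∂P, ω ∉ B₁ ∪ B₂ → entityProb v R₁ (c ω) h * entityProb v R₂ (c' ω) t ≤
      Real.exp η / ((1 - εz) * Z) ^ 2 * Real.exp (inner ℝ w (c ω)) := by
    filter_upwards [hexpo] with ω hω hωB
    simp only [hB₁def, hB₂def, mem_union, mem_ofPred_eq, not_or, not_not] at hωB
    rw [hprod, div_mul_eq_mul_div, ← Real.exp_add, pow_two]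
    have := (abs_le.1 hω).2
    refine div_le_div₀ (Real.exp_pos _).le (Real.exp_le_exp.2 (by linarith)) (by positivity) ?_
    exact mul_le_mul hωB.1.1 hωB.2.1 h1ε.le (partitionFn_pos v R₁ _ h).le
  have hgood_lo : ∀ᵐ ω ∂P, ω ∉ B₁ ∪ B₂ →
      Real.exp (-η) / ((1 + εz) * Z) ^ 2 * Real.exp (inner ℝ w (c ω)) ≤
      entityProb v R₁ (c ω) h * entityProb v R₂ (c' ω) t := by
    filter_upwards [hexpo] with ω hω hωB
    simp only [hB₁def, hB₂def, mem_union, mem_ofPred_eq, not_or, not_not] at hωB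
    rw [hprod, div_mul_eq_mul_div, ← Real.exp_add, pow_two]
    have := (abs_le.1 hω).1
    refine div_le_div₀ (Real.exp_pos _).le (Real.exp_le_exp.2 (by linarith))
      (mul_pos (partitionFn_pos v R₁ _ h) (partitionFn_pos v R₂ _ h)) ?_
    exact mul_le_mul hωB.1.2 hωB.2.2 (partitionFn_pos v R₂ _ h).le h2ε.le
  set M := ∫ x, Real.exp (inner ℝ w x) ∂(uniformSphere d) with hM
  have hup := integral_mul_le_of_le_off (G := fun ω => Real.exp (inner ℝ w (c ω)))
    (Q := Real.exp (32 * κ ^ 2)) hXY hn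
    (hint (f := fun x => (n * entityProb v R₁ x h) ^ 4) (by fun_prop))
    (hint' (f := fun x => (n * entityProb v R₂ x t) ^ 4) (by fun_prop))
    (hint hcG) (fun _ => (Real.exp_pos _).le) (hB₁.union hB₂) hρ hPB (by positivity) hgood_up
    (by rw [hval (f := fun x => (n * entityProb v R₁ x h) ^ 4) (by fun_prop)]
        exact integral_card_mul_entityProb_pow_four_le hv hR₁ h)
    (by rw [hval' (f := fun x => (n * entityProb v R₂ x t) ^ 4) (by fun_prop)]
        exact integral_card_mul_entityProb_pow_four_le hv hR₂ t)
  have hlo := le_integral_mul_of_le_off (G := fun ω => Real.exp (inner ℝ w (c ω)))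
    (Q := Real.exp (32 * κ ^ 2)) hXY
    (fun _ => (entityProb_pos ..).le) (fun _ => (entityProb_pos ..).le) (hint hcG)
    (hint (f := fun x => Real.exp (inner ℝ w x) ^ 2) (by fun_prop)) (hB₁.union hB₂) hρ hPB
    (by positivity) hgood_lo (by
      rw [hval (f := fun x => Real.exp (inner ℝ w x) ^ 2) (by fun_prop)]
      have e : ∀ x : E d, Real.exp (inner ℝ w x) ^ 2 = Real.exp (inner ℝ ((2 : ℝ) • w) x) := by
        intro x
        rw [← Real.exp_nat_mul, real_inner_smul_left]
        norm_num
      simp_rw [e]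
      -- The second moment is at most `exp (8κ²)`, so the same `Q` serves both bounds.
      refine (integral_exp_inner_le (b := 4 * κ) ?_).trans (Real.exp_le_exp.2 (by nlinarith))
      rw [norm_smul, Real.norm_ofNat]
      linarith)
  rw [hval hcG, ← hM, ← hA] at hup hlo
  have hZn := h₁.le_card_mul hv hR₁ hZ hε hδ2
  have hZn2 : Z ^ 2 ≤ 16 * Real.exp (κ ^ 2) * n ^ 2 := by
    calc Z ^ 2 ≤ (4 * n * Real.exp (κ ^ 2 / 2)) ^ 2 := by gcongr
      _ = 16 * Real.exp (κ ^ 2 / 2) ^ 2 * n ^ 2 := by ring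
      _ = _ := by rw [← Real.exp_nat_mul]; congr 3; push_cast; ring
  -- `Z = O(n)` makes the exceptional term relative to `1/Z²`.
  have hy : ρ * A / n ^ 2 ≤ 16 * Real.exp (κ ^ 2) * (ρ * A) / Z ^ 2 := by
    rw [div_le_div_iff₀ (by positivity) (by positivity)]
    nlinarith [mul_le_mul_of_nonneg_left hZn2 (by positivity : 0 ≤ ρ * A)]
  have hlog := abs_log_sub_le_of_bounds (J := jointProb P v R₁ R₂ c c' h t) (ε := εz) (η := η)
    (x := ρ * A) (y := 16 * Real.exp (κ ^ 2) * (ρ * A)) (one_le_integral_exp_inner w) hZ hε0 hε hη0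
    (by positivity) hρA (by positivity) (hup.trans (by gcongr)) hlo
  have hs : ‖w‖ ^ 2 / (2 * d) ≤ 2 * κ ^ 2 := by
    rw [div_le_iff₀ (by positivity)]
    calc ‖w‖ ^ 2 ≤ (2 * κ * √d) ^ 2 := by gcongr
      _ = _ := by rw [mul_pow, Real.sq_sqrt hd.le]; ring
  have hmgf := abs_log_integral_exp_inner_sub_le w hs
  rw [← hM] at hlog hmgf
  calc _ = |(Real.log (jointProb P v R₁ R₂ c c' h t) - (Real.log M - 2 * Real.log Z)) +
        (Real.log M - ‖w‖ ^ 2 / (2 * d))| := by congr 1; ring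
    _ ≤ _ := (abs_add_le _ _).trans (add_le_add hlog hmgf)

/-- Completing the square in `log n`. Only a decay `δ = O(1/n)` is needed, giving `ρ = O(1/√n)`. -/
lemma exp_neg_mul_log_sq_le {a : ℝ} (ha : 0 < a) {n : ℕ} (hn : 0 < n) :
    Real.exp (-(a * Real.log n ^ 2)) ≤ (Real.exp (1 / (8 * a)) / √n) ^ 2 := by
  have hn' : (0 : ℝ) < n := by exact_mod_cast hn
  rw [div_pow, Real.sq_sqrt hn'.le, ← Real.exp_nat_mul]
  nth_rewrite 2 [← Real.exp_log hn']
  rw [← Real.exp_sub, Real.exp_le_exp]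
  have e : ((2 : ℕ) : ℝ) * (1 / (8 * a)) - Real.log n + a * Real.log n ^ 2 =
      a * (Real.log n - 1 / (2 * a)) ^ 2 := by push_cast; field_simp; ring
  have : 0 ≤ a * (Real.log n - 1 / (2 * a)) ^ 2 := by positivity
  linarith

end RelWalk

end

theorem theorem1 :
    ∃ q : ℕ, ∀ κ K a : ℝ, 0 < κ → 0 < K → 0 < a →
      ∃ C : ℝ, 0 < C ∧ ∃ N : ℕ, ∀ n d : ℕ, N ≤ n → 1 ≤ d →
        ∀ (v : Fin n → RelWalk.E d) (R₁ R₂ : Matrix (Fin d) (Fin d) ℝ) (Z εz δ ε₂ : ℝ)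
          (Ω : Type*) [MeasurableSpace Ω] (P : MeasureTheory.Measure Ω)
          [MeasureTheory.IsProbabilityMeasure P] (c : ℕ → Ω → RelWalk.E d),
          (∀ i, ‖v i‖ ≤ κ * √d) →
          R₁ ∈ Matrix.orthogonalGroup (Fin d) ℝ →
          R₂ ∈ Matrix.orthogonalGroup (Fin d) ℝ →
          0 < Z → 0 ≤ εz → εz ≤ K / √n → δ ≤ Real.exp (-(a * Real.log n ^ 2)) →
          RelWalk.Concentrated v R₁ Z εz δ →
          RelWalk.IsSlowWalk P c ε₂ →
          RelWalk.Concentrated v R₂ Z εz δ ∧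
          ∀ (k : ℕ) (h t : Fin n),
            |Real.log (RelWalk.jointProb P v R₁ R₂ (c k) (c (k + 1)) h t) -
                (‖Matrix.toEuclideanLin R₁.transpose (v h) +
                    Matrix.toEuclideanLin R₂.transpose (v t)‖ ^ 2 / (2 * d) -
                  2 * Real.log Z)| ≤
              C * (1 / √n + (1 + Real.log d) ^ q / d + √d * ε₂) := by
  -- No logarithmic factor arises: the moment comparison gives a clean `O(1/d)`, so `q = 0`.
  refine ⟨0, fun κ K a hκ hK ha => ?_⟩
  obtain ⟨A, hA⟩ : ∃ A, A = Real.exp (32 * κ ^ 2) / 2 + 1 := ⟨_, rfl⟩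
  obtain ⟨D, hD⟩ : ∃ D, D = Real.exp (1 / (8 * a)) := ⟨_, rfl⟩
  have hA0 : 0 < A := by rw [hA]; positivity
  have hD0 : 0 < D := by rw [hD]; positivity
  obtain ⟨F, hF⟩ : ∃ F, F = 16 * Real.exp (κ ^ 2) * (D * A) + 2 * (D * A) := ⟨_, rfl⟩
  obtain ⟨H, hH⟩ : ∃ H, H = Real.exp (2 * κ ^ 2) * (2 * κ ^ 2) ^ 2 := ⟨_, rfl⟩
  have hF0 : 0 < F := by rw [hF]; positivity
  have hH0 : 0 < H := by rw [hH]; positivity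
  -- The threshold gives `√n ≥ 2K + 2DA`, which makes both `εz` and `ρA` at most `1/2`.
  refine ⟨κ + 6 * K + F + H, by positivity, ⌈(2 * K + 2 * (D * A)) ^ 2⌉₊, ?_⟩
  intro n d hN hd v R₁ R₂ Z εz δ ε₂ Ω _ P _ c hv hR₁ hR₂ hZ hε0 hεK hδ h₁ hwalk
  have h₂ := h₁.congr_orthogonal hR₁ hR₂
  refine ⟨h₂, fun k h t => ?_⟩
  have : NeZero d := ⟨by omega⟩
  have hd' : (0 : ℝ) < d := by exact_mod_cast hd
  have hn : (0 : ℝ) < n := by exact_mod_cast h.pos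
  have hsn : 0 < √(n : ℝ) := Real.sqrt_pos.2 hn
  have hsq : 2 * K + 2 * (D * A) ≤ √n := Real.le_sqrt_of_sq_le (Nat.ceil_le.1 hN)
  have hDA : 0 < D * A := by positivity
  have hε : εz ≤ 1 / 2 := hεK.trans (by rw [div_le_iff₀ hsn]; linarith)
  have hρA : D / √n * A ≤ 1 / 2 := by
    rw [div_mul_eq_mul_div, div_le_iff₀ hsn]; linarith
  have hε₂ : 0 ≤ ε₂ := by
    obtain ⟨ω, hω⟩ := (hwalk.slow k).exists
    exact (norm_nonneg _).trans hω
  have hδρ : δ ≤ (D / √n) ^ 2 :=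
    hδ.trans (hD ▸ RelWalk.exp_neg_mul_log_sq_le ha h.pos)
  refine (RelWalk.abs_log_jointProb_sub_le hκ hv hR₁ hR₂ hZ hε0 hε (by positivity) hδρ hA hρA h₁ h₂
    (hwalk.measurable k) (hwalk.measurable (k + 1)) (hwalk.uniform k) (hwalk.uniform (k + 1)) hε₂
    (hwalk.slow k) h t).trans ?_
  rw [← hH, pow_zero]
  have e : 16 * Real.exp (κ ^ 2) * (D / √n * A) + 2 * (D / √n * A) = F * (1 / √n) := by
    rw [hF]; ring
  have hεK' : εz ≤ K * (1 / √n) := by rwa [mul_one_div]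
  have e2 : H / d = H * (1 / d) := by ring
  have hx : 0 ≤ 1 / √(n : ℝ) := by positivity
  have hy : 0 ≤ 1 / (d : ℝ) := by positivity
  have hz : 0 ≤ √d * ε₂ := by positivity
  rw [e2]
  generalize 1 / √(n : ℝ) = x at *
  generalize 1 / (d : ℝ) = y at *
  have e3 : κ * √d * ε₂ = κ * (√d * ε₂) := by ring
  rw [e3]
  generalize √d * ε₂ = z at *
  -- These are the cross terms by which `C (x + y + z)` exceeds the needed bound.
  have : 0 ≤ (κ + H) * x + (κ + 6 * K + F) * y + (6 * K + F + H) * z := by positivity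
  linarith
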